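/- Let $q=p^r$ be a prime power, $N\ge 2$, $X_A,X_B\ge 0$ with $N>X_A+X_B$, $\lambda,\mu\ge 1$, $\eta\ge 0$, and put $R=\min\{1,\,2(1-\frac{X_A+X_B}{N})\}$. *Problem.* Matrices $A_l\in\mathbb F_q^{\lambda\times\eta}$ and $B_l\in\mathbb F_q^{\eta\times\mu}$ ($l=1,\dots,\ell$) are encoded, separately and with independent local randomness, into one share of $(A_l)_l$ and one share of $(B_l)_l$ for each of $N$ servers, such that the joint law of the $A$-shares of any at most $X_A$ servers does not depend on $(A_l)_l$, and the joint law of the $B$-shares of any at most $X_B$ servers does not depend on $(B_l)_l$. The servers hold $q$-dimensional qudits prepared in data-independent entangled states. Each server applies to its own qudits gates $\mathsf X(a)\mathsf Z(b)$, $a,b\in\mathbb F_q$, computed from its own two shares, where $\mathsf X(a)=\sum_j|j+a\rangle\langle j|$ and $\mathsf Z(b)=\sum_j e^{2\pi i\,\mathrm{tr}(bj)/p}|j\rangle\langle j|$, and sends all of its qudits to the user. The user measures them (projectively) and must recover all products $A_lB_l$ without error. The rate is the number $\ell\lambda\mu$ of desired $q$-ary symbols per downloaded qudit. *QCSA schemes.*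 Let $L\le n/2$, $n\le N$, let $\alpha_1,\dots,\alpha_n,f_1,\dots,f_L\in\mathbb F_q$ be distinct, $u_k\ne0$, $v_k=u_k^{-1}\prod_{i\ne k}(\alpha_k-\alpha_i)^{-1}$. For $\beta\in\mathbb F_q^n$ let $Q^\beta$ be the $n\times n$ matrix whose $k$-th row is $\beta_k\cdot\big(\frac1{f_1-\alpha_k},\dots,\frac1{f_L-\alpha_k},1,\alpha_k,\dots,\alpha_k^{n-L-1}\big)$. Let $M_{\rm QCSA}$ be the $n\times 2n$ matrix consisting of rows $1,\dots,L$ and $L+\lceil n/2\rceil+1,\dots,n$, followed by rows $n+1,\dots,n+L$ and $n+L+\lfloor n/2\rfloor+1,\dots,2n$, of $\operatorname{diag}(Q^u,Q^v)^{-1}$. In a QCSA scheme with $n$ active servers and dimension $L$, the products are grouped into $T$ blocks of $2L$, $\ell=2LT$. For each block and each entry $(i,j)$ of the product matrices, the active servers compute from their shares the answers of two instances $b=1,2$ of a cross-subspace alignment code: the vector of the $n$ answers equals $Q^{\mathbf 1}(\delta^b_1,\dots,\delta^b_L,\nu^b_1,\dots,\nu^b_{n-L})^\top$, where $\delta^1,\delta^2$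 are the $(i,j)$ entries of the $2L$ products of the block and $\nu^b$ is arbitrary. Server $k$ scales its two answers by $u_k$ and $v_k$ and uses them as the arguments of its gates $\mathsf X$ and $\mathsf Z$ on one qudit. The $n$ qudits form a stabilizer-based $n$-sum box with transfer matrix $M_{\rm QCSA}$: the initial state and the measurement are the stabilized state and the syndrome measurement of a maximal stabilizer, and for gate arguments $x\in\mathbb F_q^{2n}$ the measurement outcome is $M_{\rm QCSA}\,x$ with probability one. The user reads $\delta^1,\delta^2$ off the outcome. *Claim.* Put $X=\max\{1,X_A+X_B\}$, $L=\min\{N-X,X\}$, $n=L+X$ (so, if $X_A+X_B\ge1$: $n=N$ and $L=N-X_A-X_B$ when $N\le 2(X_A+X_B)$, and $n=2(X_A+X_B)$, $L=n/2$ otherwise), and suppose $q\ge n+L$. Then a QCSA scheme with $n$ active servers and dimension $L$ solves the problem above, with the stated security and zero error, at rate exactly $R$. More precisely, for every integer $K\ge1$ such that $n$ divides $KN$ (every $K\ge 1$ if $N\le 2(X_A+X_B)$), there is such a scheme that recovers exactly $K\cdot NR$ products from exactly $K\cdot N\lambda\mu$ downloaded qudits; that is, $NR$ products per $N\lambda\mu$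 qudits. -/

import Mathlib

universe u

noncomputable section

namespace QCSA

/-! ### Qudits over a finite field, Weyl operators, projective measurements -/

section Quantum

variable (p : ℕ) [Fact p.Prime] {F : Type u} [Field F] [Fintype F] [DecidableEq F]
  [Algebra (ZMod p) F]

/-- `ω ^ (tr x)` with `ω = exp (2πi/p)` and `tr` the trace from `F` to its prime field. -/
def phase (x : F) : ℂ :=
  Complex.exp (2 * Real.pi * Complex.I / p) ^ (Algebra.trace (ZMod p) F x).val

/-- The one-qudit gate `X(a) = ∑ j, |j + a⟩⟨j|`. -/
def gateX (a : F) : Matrix F F ℂ := Matrix.of fun i j => if i = j + a then 1 else 0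

/-- The one-qudit gate `Z(b) = ∑ j, ω ^ (tr (b j)) |j⟩⟨j|`. -/
def gateZ (b : F) : Matrix F F ℂ := Matrix.diagonal fun j => phase p (b * j)

/-- Tensor product of one-qudit operators; `Q` labels the qudits and the joint Hilbert space has
the orthonormal basis `Q → F`. -/
def tensorOp {Q : Type} [Fintype Q] (M : Q → Matrix F F ℂ) : Matrix (Q → F) (Q → F) ℂ :=
  Matrix.of fun i j => ∏ k, M k (i k) (j k)

/-- The Weyl operator `⨂ k, X(x_k) Z(x_{k'})`, where `inl k` and `inr k` label the two inputs
of qudit `k`. -/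
def weyl {Q : Type} [Fintype Q] (x : Q ⊕ Q → F) : Matrix (Q → F) (Q → F) ℂ :=
  tensorOp fun k => gateX (x (Sum.inl k)) * gateZ p (x (Sum.inr k))

/-- The trace-symplectic character `ω ^ tr (vᵀ J w)`. -/
def sympPhase {Q : Type} [Fintype Q] [DecidableEq Q] (v w : Q ⊕ Q → F) : ℂ :=
  phase p (v ⬝ᵥ (Matrix.J Q F).mulVec w)

/-- A projection-valued measurement with outcomes in `Y` on the Hilbert space with
orthonormal basis `H`. -/
structure PVM (Y H : Type u) [Fintype Y] [Fintype H] [DecidableEq H] where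
  proj : Y → Matrix H H ℂ
  isHermitian : ∀ y, (proj y).IsHermitian
  idempotent : ∀ y, proj y * proj y = proj y
  orthogonal : ∀ y y', y ≠ y' → proj y * proj y' = 0
  complete : ∑ y, proj y = 1

/-- Born rule: the probability `⟨φ, P_y φ⟩` of outcome `y` in the pure state `φ`. -/
def outcomeProb {Y H : Type u} [Fintype Y] [Fintype H] [DecidableEq H]
    (P : PVM Y H) (φ : H → ℂ) (y : Y) : ℝ :=
  (star φ ⬝ᵥ (P.proj y).mulVec φ).re

/-- The state `ψ` and the measurement `P` realize the sum box `y = M x`: if the Weyl operator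
given by the inputs `x` is applied to the shared state `ψ`, then measuring `P` gives the outcome
`M x` with probability one. -/
def RealizesSumBox {Q R : Type} [Fintype Q] [DecidableEq Q] [Fintype R] [DecidableEq R]
    (ψ : (Q → F) → ℂ) (P : PVM (R → F) (Q → F)) (M : Matrix R (Q ⊕ Q) F) : Prop :=
  ∀ x : Q ⊕ Q → F, outcomeProb P ((weyl p x).mulVec ψ) (M.mulVec x) = 1

/-- The state `ψ` and the measurement `P` come from a maximal stabilizer and `M` is the resulting
transfer matrix: `G` is strongly self-orthogonal (self-orthogonal, with as many independent
columns as there are qudits), `(G H)` is invertible and `M` is the bottom block of its inverse;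
the operators `W g = c g • weyl (G g)` form a stabilizer group, `P` is the measurement that
simultaneously diagonalizes it, with cosets labelled by `s` through `H s`, and `ψ` is its
stabilized state. -/
def IsStabilizerBased {Q R : Type} [Fintype Q] [DecidableEq Q] [Fintype R] [DecidableEq R]
    (ψ : (Q → F) → ℂ) (P : PVM (R → F) (Q → F)) (M : Matrix R (Q ⊕ Q) F) : Prop :=
  ∃ (G H : Matrix (Q ⊕ Q) R F) (K : Matrix R (Q ⊕ Q) F) (c : (R → F) → ℂ),
    G.transpose * Matrix.J Q F * G = 0 ∧
    Matrix.fromCols G H * Matrix.fromRows K M = 1 ∧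
    Matrix.fromRows K M * Matrix.fromCols G H = 1 ∧
    (∀ g, c g ≠ 0) ∧
    (∀ g g', (c g • weyl p (G.mulVec g)) * (c g' • weyl p (G.mulVec g')) =
      c (g + g') • weyl p (G.mulVec (g + g'))) ∧
    (∀ g, c g • weyl p (G.mulVec g) =
      ∑ s, sympPhase p (G.mulVec g) (H.mulVec s) • P.proj s) ∧
    (P.proj 0).mulVec ψ = ψ

end Quantum

/-! ### Quantum secure distributed batch matrix multiplication -/

/-- A scheme with `N` servers for a batch, indexed by `ι`, of products
`A l * B l` of `lam × eta` and `eta × mu` matrices over `F`.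

The two sources encode `A` and `B` separately, with independent local noise, into one share of
each per server. The servers hold, for each `c : Use`, a fresh system of qudits labelled by `Qd`
in a fixed entangled pure state that does not depend on any data; qudit `k` is held by the server
`owner k`, which applies to it a gate `X(a) Z(b)` with `a`, `b` computed from its own two shares.
All qudits are then sent to the user, who measures every system (with outcomes in `Out`) and
decodes. -/
structure Scheme (F : Type u) [Field F] [Fintype F] [DecidableEq F]
    (N : ℕ) (ι Use Qd : Type) (Out : Type u) [Fintype Qd] [DecidableEq Qd] [Fintype Out]
    (lam eta mu : ℕ) where
  NoiseA : Type u
  NoiseB : Type u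
  ShareA : Type u
  ShareB : Type u
  noiseA : PMF NoiseA
  noiseB : PMF NoiseB
  encA : Fin N → (ι → Matrix (Fin lam) (Fin eta) F) → NoiseA → ShareA
  encB : Fin N → (ι → Matrix (Fin eta) (Fin mu) F) → NoiseB → ShareB
  owner : Qd → Fin N
  state : Use → (Qd → F) → ℂ
  state_unit : ∀ c, ∑ j, ‖state c j‖ ^ 2 = 1
  gateInput : Use → Qd → ShareA → ShareB → F × F
  measurement : Use → PVM Out (Qd → F)
  decode : (Use → Out) → ι → Matrix (Fin lam) (Fin mu) F

namespace Scheme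

variable {F : Type u} [Field F] [Fintype F] [DecidableEq F]
  {N : ℕ} {ι Use Qd : Type} {Out : Type u} [Fintype Qd] [DecidableEq Qd] [Fintype Out]
  {lam eta mu : ℕ}

/-- The joint law of the `A`-shares of any at most `X` servers does not depend on the
matrices `A` (equivalently, these shares are independent of `A` whatever the law of `A`). -/
def SecureA (S : Scheme F N ι Use Qd Out lam eta mu) (X : ℕ) : Prop :=
  ∀ C : Finset (Fin N), C.card ≤ X → ∀ A A' : ι → Matrix (Fin lam) (Fin eta) F,
    S.noiseA.map (fun z (n : C) => S.encA n A z) = S.noiseA.map (fun z (n : C) => S.encA n A' z)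

/-- The joint law of the `B`-shares of any at most `X` servers does not depend on the
matrices `B`. -/
def SecureB (S : Scheme F N ι Use Qd Out lam eta mu) (X : ℕ) : Prop :=
  ∀ C : Finset (Fin N), C.card ≤ X → ∀ B B' : ι → Matrix (Fin eta) (Fin mu) F,
    S.noiseB.map (fun z (n : C) => S.encB n B z) = S.noiseB.map (fun z (n : C) => S.encB n B' z)

/-- The vector of all gate inputs in use `c`: `inl k` is the argument of `X` and `inr k` the
argument of `Z` at qudit `k`. -/
def inputs (S : Scheme F N ι Use Qd Out lam eta mu) (c : Use)
    (A : ι → Matrix (Fin lam) (Fin eta) F) (B : ι → Matrix (Fin eta) (Fin mu) F)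
    (zA : S.NoiseA) (zB : S.NoiseB) : Qd ⊕ Qd → F :=
  Sum.elim
    (fun k => (S.gateInput c k (S.encA (S.owner k) A zA) (S.encB (S.owner k) B zB)).1)
    (fun k => (S.gateInput c k (S.encA (S.owner k) A zA) (S.encB (S.owner k) B zB)).2)

/-- Zero-error decoding: every family of measurement outcomes of nonzero probability (the product
of the probabilities for the separate systems) is decoded to the true products. -/
def Correct (p : ℕ) [Fact p.Prime] [Algebra (ZMod p) F] [Fintype Use]
    (S : Scheme F N ι Use Qd Out lam eta mu) : Prop :=
  ∀ (A : ι → Matrix (Fin lam) (Fin eta) F) (B : ι → Matrix (Fin eta) (Fin mu) F),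
    ∀ zA ∈ S.noiseA.support, ∀ zB ∈ S.noiseB.support, ∀ y : Use → Out,
      (∏ c, outcomeProb (S.measurement c)
        ((weyl p (S.inputs c A B zA zB)).mulVec (S.state c)) (y c)) ≠ 0 →
      ∀ l, S.decode y l = A l * B l

/-- The number of products that are computed. -/
def numProducts [Fintype ι] (_S : Scheme F N ι Use Qd Out lam eta mu) : ℕ := Fintype.card ι

/-- The total number of qudits downloaded from the servers. -/
def numQudits [Fintype Use] (_S : Scheme F N ι Use Qd Out lam eta mu) : ℕ :=
  Fintype.card Use * Fintype.card Qd

/-- Desired `q`-ary symbols per downloaded qudit. -/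
def rate [Fintype ι] [Fintype Use] (S : Scheme F N ι Use Qd Out lam eta mu) : ℝ :=
  ((S.numProducts * (lam * mu) : ℕ) : ℝ) / (S.numQudits : ℝ)

end Scheme

/-! ### CSA and QCSA codes -/

section Codes

variable {F : Type u} [Field F] {n L : ℕ}

/-- The `n × n` QCSA matrix: `L` Cauchy columns `β_k / (f_l - α_k)`, followed by `n - L`
Vandermonde columns `β_k α_k ^ m`. -/
def qcsaMatrix (α β : Fin n → F) (f : Fin L → F) : Matrix (Fin n) (Fin n) F :=
  Matrix.of fun k c =>
    if h : c.val < L then β k / (f ⟨c.val, h⟩ - α k) else β k * α k ^ (c.val - L)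

/-- The CSA (Cauchy-Vandermonde) matrix. -/
def csaMatrix (α : Fin n → F) (f : Fin L → F) : Matrix (Fin n) (Fin n) F :=
  qcsaMatrix α (fun _ => 1) f

/-- The multipliers `v_j = u_j⁻¹ (∏_{i ≠ j} (α_j - α_i))⁻¹` of the dual GRS code. -/
def dualMultiplier (α u : Fin n → F) (j : Fin n) : F :=
  (u j)⁻¹ * (∏ i ∈ Finset.univ.erase j, (α j - α i))⁻¹

/-- Labels of the `n` outputs of the QCSA box: `L` desired symbols and `⌊n/2⌋ - L` interference
symbols of the first instance, `L` desired symbols and `⌈n/2⌉ - L` interference symbols of the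
second one. -/
abbrev BoxOutput (n L : ℕ) : Type :=
  (Fin L ⊕ Fin (n / 2 - L)) ⊕ (Fin L ⊕ Fin ((n + 1) / 2 - L))

/-- The 0-1 matrix that keeps, of two vectors of length `n`, the first `L` entries of each and
the last `⌊n/2⌋ - L`, respectively `⌈n/2⌉ - L`, entries. -/
def selection (F : Type u) [Field F] (n L : ℕ) :
    Matrix (BoxOutput n L) (Fin n ⊕ Fin n) F :=
  Matrix.of fun r c => match r, c with
    | Sum.inl (Sum.inl l), Sum.inl c => if c.val = l.val then 1 else 0
    | Sum.inl (Sum.inr m), Sum.inl c => if c.val = L + (n + 1) / 2 + m.val then 1 else 0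
    | Sum.inr (Sum.inl l), Sum.inr c => if c.val = l.val then 1 else 0
    | Sum.inr (Sum.inr m), Sum.inr c => if c.val = L + n / 2 + m.val then 1 else 0
    | _, _ => 0

/-- The transfer matrix of the QCSA box. -/
def qcsaTransfer (α u : Fin n → F) (f : Fin L → F) :
    Matrix (BoxOutput n L) (Fin n ⊕ Fin n) F :=
  selection F n L *
    (Matrix.fromBlocks (qcsaMatrix α u f) 0 0 (qcsaMatrix α (dualMultiplier α u) f))⁻¹

/-- The output position of desired symbol `l` of instance `b`. -/
def desiredOutput (b : Fin 2) (l : Fin L) : BoxOutput n L :=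
  if b = 0 then Sum.inl (Sum.inl l) else Sum.inr (Sum.inl l)

end Codes

/-- The scheme is a QCSA scheme on `n` of the `N` servers, in `T` blocks: for each block `t` and
each matrix entry `(i, j)` the `n` servers form the answers of two instances (`b : Fin 2`) of a
classical CSA code, each of which carries the `(i, j)` entries of `L` desired products on the
Cauchy columns (and arbitrary interference on the Vandermonde columns); server `k` scales its two
answers by `u_k` and `v_k` and feeds them to the stabilizer-based sum box with the QCSA transfer
matrix, using one qudit; the user reads off the desired symbols from the outputs of the box. -/
def IsQCSA (p : ℕ) [Fact p.Prime] {F : Type u} [Field F] [Fintype F] [DecidableEq F]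
    [Algebra (ZMod p) F] {N n L T lam eta mu : ℕ}
    (S : Scheme F N (Fin T × Fin 2 × Fin L) (Fin T × Fin lam × Fin mu) (Fin n)
      (BoxOutput n L → F) lam eta mu) : Prop :=
  2 * L ≤ n ∧ Function.Injective S.owner ∧
  ∃ (α u : Fin n → F) (f : Fin L → F)
    (ans : Fin T × Fin lam × Fin mu → Fin 2 → Fin n → S.ShareA → S.ShareB → F),
    Function.Injective (Sum.elim α f) ∧ (∀ k, u k ≠ 0) ∧
    (∀ A B, ∀ zA ∈ S.noiseA.support, ∀ zB ∈ S.noiseB.support, ∀ t i j b,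
      ∃ x : Fin n → F,
        (∀ (l : Fin L) (c : Fin n), c.val = l.val → x c = (A (t, b, l) * B (t, b, l)) i j) ∧
        (fun k => ans (t, i, j) b k (S.encA (S.owner k) A zA) (S.encB (S.owner k) B zB)) =
          (csaMatrix α f).mulVec x) ∧
    (∀ c k a b, S.gateInput c k a b =
      (u k * ans c 0 k a b, dualMultiplier α u k * ans c 1 k a b)) ∧
    (∀ c, RealizesSumBox p (S.state c) (S.measurement c) (qcsaTransfer α u f) ∧
      IsStabilizerBased p (S.state c) (S.measurement c) (qcsaTransfer α u f)) ∧
    (∀ y t b l i j, S.decode y (t, b, l) i j = y (t, i, j) (desiredOutput b l))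

/-- Number of interference dimensions of the CSA code: `XA + XB`, or `1` if there is no security
requirement at all. -/
def interferenceDim (XA XB : ℕ) : ℕ := max 1 (XA + XB)

/-- Number of desired symbols per CSA instance: all of `N - (XA + XB)` if this is at most `N / 2`,
otherwise the number that remains after redundant servers are discarded. -/
def csaDim (N XA XB : ℕ) : ℕ := min (N - interferenceDim XA XB) (interferenceDim XA XB)

/-- Number of servers that are employed: all `N` servers if `N ≤ 2 (XA + XB)`, otherwise
`2 (XA + XB)`. -/
def activeServers (N XA XB : ℕ) : ℕ := csaDim N XA XB + interferenceDim XA XB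

end QCSA

end

/-! Classical part. Put δ = f_l - α_k. Both shares are masked by polynomials in δ without constant
term, so an entry of their product is P_l(δ) with the desired symbol as constant coefficient and deg
P_l ≤ X_A + X_B. Dividing by δ leaves desired/δ plus a polynomial of degree at most X_A + X_B - 1
(or 0). Summed over l, the L desired symbols occupy the Cauchy columns and all interference falls
into d = max(1, X_A + X_B) common Vandermonde columns (`exists_csaMatrix_mulVec_eq`). Security holds
because a translation of the uniform noise turns the shares of one data set into those of another
(`exists_maskedShare_shift`).

Quantum part. Two instances, scaled by u and v, give 2n coordinates, of which a box on n qudits can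
output n. The n that are lost are interference: ⌈n/2⌉ Vandermonde columns of the u-code and ⌊n/2⌋ of
the v-code. Since v is dual to u and the exponents add up to at most n - 2, these columns are
orthogonal (`sum_dualMultiplier_mul_pow`), so they generate a maximal stabilizer of CSS type.
Displacements along it change the stabilized state only by a phase, and a displacement x shifts the
syndrome by Mx (`weyl_mul_eigenProj`). The coordinates exist because Cauchy-Vandermonde matrices are
invertible (`isUnit_qcsaMatrix`).

Thus n qudits carry 2L desired symbols, and 2L/n = R. -/

noncomputable section

namespace QCSA

set_option linter.unusedSectionVars false

/-! ### Additive characters of the field -/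

section Phase

variable (p : ℕ) [Fact p.Prime] {F : Type u} [Field F] [Algebra (ZMod p) F]

theorem exp_pow_prime_eq_one : Complex.exp (2 * Real.pi * Complex.I / p) ^ p = 1 :=
  (Complex.isPrimitiveRoot_exp p (Fact.out : p.Prime).ne_zero).pow_eq_one

/-- `phase` as an additive character. -/
def phaseChar (F : Type u) [Field F] [Algebra (ZMod p) F] : AddChar F ℂ :=
  (AddChar.zmodChar p (exp_pow_prime_eq_one p)).compAddMonoidHom
    (Algebra.trace (ZMod p) F).toAddMonoidHom

theorem phase_zero : phase p (0 : F) = 1 := AddChar.map_zero_eq_one (phaseChar p F)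

theorem phase_add (x y : F) : phase p (x + y) = phase p x * phase p y :=
  AddChar.map_add_eq_mul (phaseChar p F) x y

theorem norm_phase (x : F) : ‖phase p x‖ = 1 := by
  unfold phase
  rw [norm_pow]
  have := (Complex.isPrimitiveRoot_exp p (Fact.out : p.Prime).ne_zero).norm'_eq_one
    (Fact.out : p.Prime).ne_zero
  rw [this, one_pow]

theorem phase_neg (x : F) : phase p (-x) = star (phase p x) := by
  have h : phase p (-x) * phase p x = 1 := by rw [← phase_add, neg_add_cancel, phase_zero]
  have h2 : star (phase p x) * phase p x = 1 := by
    rw [Complex.star_def, ← Complex.normSq_eq_conj_mul_self, Complex.normSq_eq_norm_sq,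
      norm_phase]
    simp
  have h0 : phase p x ≠ 0 := fun h => by simp [h] at h2
  exact mul_right_cancel₀ h0 (h.trans h2.symm)

theorem phase_sum {ι : Type*} (s : Finset ι) (f : ι → F) :
    phase p (∑ k ∈ s, f k) = ∏ k ∈ s, phase p (f k) := by
  classical
  induction s using Finset.induction_on with
  | empty => simp [phase_zero]
  | insert a s ha ih => rw [Finset.sum_insert ha, Finset.prod_insert ha, phase_add, ih]

theorem exists_phase_ne_one [Finite F] : ∃ x : F, phase p x ≠ 1 := by
  have : Module.Finite (ZMod p) F := inferInstance
  have htr := Algebra.trace_surjective (ZMod p) F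
  obtain ⟨x, hx⟩ := htr 1
  refine ⟨x, ?_⟩
  unfold phase
  rw [hx, ZMod.val_one, pow_one]
  exact (Complex.isPrimitiveRoot_exp p (Fact.out : p.Prime).ne_zero).ne_one
    (Fact.out : p.Prime).one_lt

/-- Orthogonality of characters on `R → F`. -/
theorem sum_phase_dotProduct {R : Type} [Fintype R] [DecidableEq R] [Fintype F] [DecidableEq F]
    (w : R → F) :
    ∑ s : R → F, phase p (w ⬝ᵥ s) = if w = 0 then (Fintype.card (R → F) : ℂ) else 0 := by
  let ψ : AddChar (R → F) ℂ := (phaseChar p F).compAddMonoidHom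
    (AddMonoidHom.mk' (fun s : R → F => w ⬝ᵥ s) (fun a b => dotProduct_add w a b))
  have hψ : ∀ s, ψ s = phase p (w ⬝ᵥ s) := fun s => rfl
  simp_rw [← hψ]
  split_ifs with h
  · simp [hψ, h, phase_zero]
  · rw [AddChar.sum_eq_zero_iff_ne_zero]
    intro h0
    obtain ⟨k, hk⟩ := Function.ne_iff.mp h
    obtain ⟨a, ha⟩ := exists_phase_ne_one p (F := F)
    apply ha
    -- At this vector the pairing with `w` equals `a`, where the phase is not 1.
    have := hψ (Pi.single k ((w k)⁻¹ * a))
    rw [h0, AddChar.zero_apply, dotProduct_single, mul_inv_cancel_left₀ hk] at this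
    exact this.symm

end Phase

/-! ### The symplectic form -/

section Symplectic

variable {F : Type u} [Field F] {Q : Type} [Fintype Q]

theorem dotProduct_J_mulVec [DecidableEq Q] (x y : Q ⊕ Q → F) :
    x ⬝ᵥ (Matrix.J Q F).mulVec y =
      (x ∘ Sum.inr) ⬝ᵥ (y ∘ Sum.inl) - (y ∘ Sum.inr) ⬝ᵥ (x ∘ Sum.inl) := by
  simp only [Matrix.J, Matrix.fromBlocks_mulVec, dotProduct, Fintype.sum_sum_type]
  simp [Matrix.neg_mulVec, mul_comm, Function.comp_def]
  ring

theorem dotProduct_J_mulVec_neg_symm [DecidableEq Q] (x y : Q ⊕ Q → F) :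
    x ⬝ᵥ (Matrix.J Q F).mulVec y = - (y ⬝ᵥ (Matrix.J Q F).mulVec x) := by
  rw [dotProduct_J_mulVec, dotProduct_J_mulVec]; ring

end Symplectic

/-! ### Weyl operators and their commutation relations -/

section Weyl

open Matrix

variable (p : ℕ) [Fact p.Prime] {F : Type u} [Field F] [Fintype F] [DecidableEq F]
  [Algebra (ZMod p) F] {Q : Type} [Fintype Q]

theorem weyl_apply [DecidableEq Q] (x : Q ⊕ Q → F) (i j : Q → F) :
    weyl p x i j = if i = j + x ∘ Sum.inl then phase p ((x ∘ Sum.inr) ⬝ᵥ j) else 0 := by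
  have h1 : ∀ k, (gateX (x (Sum.inl k)) * gateZ p (x (Sum.inr k))) (i k) (j k) =
      if i k = j k + x (Sum.inl k) then phase p (x (Sum.inr k) * j k) else 0 := by
    intro k
    simp [gateZ, gateX, Matrix.mul_diagonal, ite_mul]
  simp only [weyl, tensorOp, Matrix.of_apply, h1]
  split_ifs with h
  · subst h
    simp [dotProduct, phase_sum]
  · obtain ⟨k, hk⟩ := Function.ne_iff.mp h
    exact Finset.prod_eq_zero (Finset.mem_univ k) (if_neg (by simpa using hk))

theorem weyl_mul [DecidableEq Q] (x y : Q ⊕ Q → F) :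
    weyl p x * weyl p y =
      phase p ((x ∘ Sum.inr) ⬝ᵥ (y ∘ Sum.inl)) • weyl p (x + y) := by
  ext i j
  rw [Matrix.mul_apply, Finset.sum_eq_single (j + y ∘ Sum.inl)]
  · rw [Matrix.smul_apply, weyl_apply, weyl_apply, weyl_apply, if_pos rfl]
    have e1 : (x + y) ∘ (Sum.inl : Q → Q ⊕ Q) = x ∘ Sum.inl + y ∘ Sum.inl := rfl
    have e2 : (x + y) ∘ (Sum.inr : Q → Q ⊕ Q) = x ∘ Sum.inr + y ∘ Sum.inr := rfl
    have e3 : j + y ∘ Sum.inl + x ∘ Sum.inl = j + (x ∘ Sum.inl + y ∘ Sum.inl) := by abel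
    rw [e1, e2, e3]
    split_ifs
    · rw [dotProduct_add, add_dotProduct, phase_add, phase_add, smul_eq_mul]
      ring
    · simp
  · intro k _ hk
    rw [weyl_apply p y, if_neg hk, mul_zero]
  · simp

theorem weyl_zero [DecidableEq Q] : weyl p (0 : Q ⊕ Q → F) = 1 := by
  ext i j
  rw [weyl_apply, Matrix.one_apply]
  have e1 : (0 : Q ⊕ Q → F) ∘ (Sum.inl : Q → Q ⊕ Q) = 0 := rfl
  have e2 : (0 : Q ⊕ Q → F) ∘ (Sum.inr : Q → Q ⊕ Q) = 0 := rfl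
  rw [e1, e2, add_zero, zero_dotProduct, phase_zero]

theorem weyl_mul_comm [DecidableEq Q] (x y : Q ⊕ Q → F) :
    weyl p x * weyl p y = sympPhase p x y • (weyl p y * weyl p x) := by
  rw [weyl_mul, weyl_mul, smul_smul, sympPhase, ← phase_add, dotProduct_J_mulVec,
    sub_add_cancel, add_comm]

theorem weyl_conjTranspose [DecidableEq Q] (x : Q ⊕ Q → F) :
    (weyl p x)ᴴ = phase p ((x ∘ Sum.inr) ⬝ᵥ (x ∘ Sum.inl)) • weyl p (-x) := by
  ext i j
  rw [Matrix.conjTranspose_apply, Matrix.smul_apply, weyl_apply, weyl_apply]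
  have e1 : (-x) ∘ (Sum.inl : Q → Q ⊕ Q) = -(x ∘ Sum.inl) := rfl
  have e2 : (-x) ∘ (Sum.inr : Q → Q ⊕ Q) = -(x ∘ Sum.inr) := rfl
  rw [e1, e2]
  by_cases h : j = i + x ∘ Sum.inl
  · rw [if_pos h, if_pos (by rw [h]; abel), ← phase_neg, smul_eq_mul, ← phase_add, h,
      neg_dotProduct, dotProduct_add]
    congr 1; ring
  · rw [if_neg h, if_neg (fun h' => h (by rw [h']; abel))]
    simp

theorem weyl_conjTranspose_mul_self [DecidableEq Q] (x : Q ⊕ Q → F) :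
    (weyl p x)ᴴ * weyl p x = 1 := by
  have e2 : (-x) ∘ (Sum.inr : Q → Q ⊕ Q) = -(x ∘ Sum.inr) := rfl
  rw [weyl_conjTranspose, Matrix.smul_mul, weyl_mul, smul_smul, ← phase_add, neg_add_cancel,
    weyl_zero, e2, neg_dotProduct, add_neg_cancel, phase_zero, one_smul]

end Weyl

/-! ### Joint spectral decomposition of a unitary representation of `R → F` -/

section Spectral

open Matrix

variable (p : ℕ) [Fact p.Prime] {F : Type u} [Field F] [Fintype F] [DecidableEq F]
  [Algebra (ZMod p) F] {R : Type} [Fintype R] [DecidableEq R] {D : Type u} [Fintype D]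
  [DecidableEq D]

theorem sum_phase_left (B : Matrix R R F) (hB : IsUnit B) (s : R → F) :
    ∑ g : R → F, phase p (g ⬝ᵥ B *ᵥ s) =
      if s = 0 then (Fintype.card (R → F) : ℂ) else 0 := by
  have hinj := Matrix.mulVec_injective_of_isUnit hB
  have : B *ᵥ s = 0 ↔ s = 0 := ⟨fun h => hinj (by simpa using h), fun h => by simp [h]⟩
  simp_rw [dotProduct_comm _ (B *ᵥ s)]
  rw [sum_phase_dotProduct]
  simp only [this]

theorem sum_phase_right (B : Matrix R R F) (hB : IsUnit B) (g : R → F) :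
    ∑ s : R → F, phase p (g ⬝ᵥ B *ᵥ s) =
      if g = 0 then (Fintype.card (R → F) : ℂ) else 0 := by
  have hinj := Matrix.vecMul_injective_of_isUnit hB
  have : g ᵥ* B = 0 ↔ g = 0 := ⟨fun h => hinj (by simpa using h), fun h => by simp [h]⟩
  simp_rw [dotProduct_mulVec]
  rw [sum_phase_dotProduct]
  simp only [this]

/-- The projection onto the joint eigenspace, labelled by `s`, of the commuting operators
`U g`. -/
def eigenProj (U : (R → F) → Matrix D D ℂ) (B : Matrix R R F) (s : R → F) : Matrix D D ℂ :=
  (Fintype.card (R → F) : ℂ)⁻¹ • ∑ g, phase p (-(g ⬝ᵥ B *ᵥ s)) • U g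

variable {U : (R → F) → Matrix D D ℂ} {B : Matrix R R F}

/-- Translating the summation index by `g` in the Fourier average pulls out the character value at
`g`. -/
theorem mul_eigenProj (hadd : ∀ g g', U g * U g' = U (g + g')) (g s : R → F) :
    U g * eigenProj p U B s = phase p (g ⬝ᵥ B *ᵥ s) • eigenProj p U B s := by
  rw [eigenProj, Matrix.mul_smul, smul_comm _ (_ : ℂ)⁻¹, Finset.mul_sum,
    Finset.smul_sum (s := Finset.univ) (r := phase p _)]
  congr 1
  rw [← Equiv.sum_comp (Equiv.addLeft g) (fun g' => phase p (g ⬝ᵥ B *ᵥ s) •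
    phase p (-(g' ⬝ᵥ B *ᵥ s)) • U g')]
  refine Finset.sum_congr rfl fun g' _ => ?_
  rw [Matrix.mul_smul, hadd, smul_smul, ← phase_add, Equiv.coe_addLeft, add_dotProduct]
  congr 2; ring

theorem eigenProj_mul_eigenProj (hB : IsUnit B) (hadd : ∀ g g', U g * U g' = U (g + g'))
    (s s' : R → F) :
    eigenProj p U B s * eigenProj p U B s' = if s = s' then eigenProj p U B s else 0 := by
  conv_lhs => rw [eigenProj]
  rw [Matrix.smul_mul, Finset.sum_mul]
  simp_rw [Matrix.smul_mul, mul_eigenProj p hadd, smul_smul, ← phase_add]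
  have h1 : ∀ g : R → F, -(g ⬝ᵥ B *ᵥ s) + g ⬝ᵥ B *ᵥ s' = g ⬝ᵥ B *ᵥ (s' - s) := by
    intro g; rw [mulVec_sub, dotProduct_sub]; ring
  simp_rw [h1]
  rw [← Finset.sum_smul, sum_phase_left p B hB, smul_smul]
  have h0 : (Fintype.card (R → F) : ℂ) ≠ 0 := Nat.cast_ne_zero.2 Fintype.card_ne_zero
  by_cases h : s = s'
  · subst h
    simp only [sub_self, if_true, inv_mul_cancel₀ h0, one_smul]
  · rw [if_neg h, if_neg (fun h' => h (sub_eq_zero.1 h').symm), mul_zero, zero_smul]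

/-- Fourier inversion: the sum over `s` annihilates every `U g'` with `g' ≠ g`. At `g = 0` it gives
completeness of the projections. -/
theorem sum_phase_smul_eigenProj (hB : IsUnit B) (g : R → F) :
    ∑ s, phase p (g ⬝ᵥ B *ᵥ s) • eigenProj p U B s = U g := by
  have h0 : (Fintype.card (R → F) : ℂ) ≠ 0 := Nat.cast_ne_zero.2 Fintype.card_ne_zero
  simp_rw [eigenProj, smul_comm _ ((Fintype.card (R → F) : ℂ)⁻¹), ← Finset.smul_sum]
  simp_rw [Finset.smul_sum (s := Finset.univ) (r := phase p _)]
  rw [Finset.sum_comm]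
  have h1 : ∀ g' : R → F, ∑ s : R → F, phase p (g ⬝ᵥ B *ᵥ s) • phase p (-(g' ⬝ᵥ B *ᵥ s)) • U g' =
      (if g - g' = 0 then (Fintype.card (R → F) : ℂ) else 0) • U g' := by
    intro g'
    simp_rw [smul_smul, ← phase_add, ← sub_eq_add_neg, ← sub_dotProduct]
    rw [← Finset.sum_smul, sum_phase_right p B hB]
  simp_rw [h1, sub_eq_zero, ite_smul, zero_smul]
  rw [Finset.sum_ite_eq, if_pos (Finset.mem_univ _), smul_smul, inv_mul_cancel₀ h0, one_smul]

theorem eigenProj_isHermitian (hadj : ∀ g, (U g)ᴴ = U (-g)) (s : R → F) :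
    (eigenProj p U B s).IsHermitian := by
  unfold Matrix.IsHermitian
  rw [eigenProj, conjTranspose_smul, conjTranspose_sum]
  congr 1
  · simp
  · rw [← Equiv.sum_comp (Equiv.neg (R → F)) (fun g => phase p (-(g ⬝ᵥ B *ᵥ s)) • U g)]
    refine Finset.sum_congr rfl fun g _ => ?_
    rw [conjTranspose_smul, hadj, ← phase_neg, Equiv.neg_apply, neg_dotProduct]

end Spectral

/-! ### Sum boxes from CSS stabilizers -/

section Stabilizer

open Matrix

variable (p : ℕ) [Fact p.Prime] {F : Type u} [Field F] [Fintype F] [DecidableEq F]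
  [Algebra (ZMod p) F] {Q R : Type} [Fintype Q] [DecidableEq Q] [Fintype R] [DecidableEq R]
  {G H : Matrix (Q ⊕ Q) R F} {K M : Matrix R (Q ⊕ Q) F}

theorem dotProduct_J_mulVec_eq_pairing (G H : Matrix (Q ⊕ Q) R F) (g s : R → F) :
    (G *ᵥ g) ⬝ᵥ (Matrix.J Q F) *ᵥ (H *ᵥ s) = g ⬝ᵥ (Gᵀ * Matrix.J Q F * H) *ᵥ s := by
  rw [← mulVec_mulVec, ← mulVec_mulVec, dotProduct_mulVec g, vecMul_transpose]

/-- The columns of `G` span an isotropic space, so the nondegenerate form must pair it perfectly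
with the complement spanned by `H`. Explicitly, isotropy allows `H * M` to be replaced by `G * K + H
* M = 1`, after which `J` cancels and `K * G = 1` finishes. -/
theorem isUnit_pairing (hiso : Gᵀ * Matrix.J Q F * G = 0)
    (hGH : fromCols G H * fromRows K M = 1) (hKM : fromRows K M * fromCols G H = 1) :
    IsUnit (Gᵀ * Matrix.J Q F * H) := by
  have hsum : G * K + H * M = 1 := by rw [← hGH, fromCols_mul_fromRows]
  have hKG : K * G = 1 := by
    rw [fromRows_mul_fromCols, ← fromBlocks_one] at hKM
    exact (fromBlocks_inj.1 hKM).1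
  have hJ : Matrix.J Q F * -Matrix.J Q F = 1 := by
    rw [Matrix.mul_neg, Matrix.J_squared, neg_neg]
  rw [Matrix.isUnit_iff_isUnit_det]
  refine Matrix.isUnit_det_of_right_inverse (B := M * (-Matrix.J Q F * Kᵀ)) ?_
  calc Gᵀ * Matrix.J Q F * H * (M * (-Matrix.J Q F * Kᵀ))
      = Gᵀ * Matrix.J Q F * (G * K + H * M) * (-Matrix.J Q F * Kᵀ) := by
        rw [Matrix.mul_add, ← Matrix.mul_assoc _ G K, hiso, Matrix.zero_mul, zero_add]
        simp only [Matrix.mul_assoc]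
    _ = Gᵀ * (Matrix.J Q F * -Matrix.J Q F) * Kᵀ := by
        rw [hsum, Matrix.mul_one]; simp only [Matrix.mul_assoc]
    _ = 1 := by rw [hJ, Matrix.mul_one, ← transpose_mul, hKG, transpose_one]

/-- The measurement that simultaneously diagonalizes the Weyl operators of the columns of `G`. -/
def stabilizerPVM (hB : IsUnit (Gᵀ * Matrix.J Q F * H))
    (hcss : ∀ g g' : R → F, ((G *ᵥ g) ∘ Sum.inr) ⬝ᵥ ((G *ᵥ g') ∘ Sum.inl) = 0) :
    PVM (R → F) (Q → F) :=
  -- The CSS condition removes the cocycle of `weyl_mul`, so no phase correction is needed to obtain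
  -- a representation.
  have hadd : ∀ g g' : R → F, weyl p (G *ᵥ g) * weyl p (G *ᵥ g') = weyl p (G *ᵥ (g + g')) := by
    intro g g'
    rw [weyl_mul, hcss, phase_zero, one_smul, mulVec_add]
  have hadj : ∀ g : R → F, (weyl p (G *ᵥ g))ᴴ = weyl p (G *ᵥ (-g)) := by
    intro g
    rw [weyl_conjTranspose, hcss, phase_zero, one_smul, mulVec_neg]
  { proj := eigenProj p (fun g => weyl p (G *ᵥ g)) (Gᵀ * Matrix.J Q F * H)
    isHermitian := eigenProj_isHermitian p hadj
    idempotent := fun s => by rw [eigenProj_mul_eigenProj p hB hadd, if_pos rfl]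
    orthogonal := fun s s' h => by rw [eigenProj_mul_eigenProj p hB hadd, if_neg h]
    complete := by
      have := sum_phase_smul_eigenProj p (U := fun g => weyl p (G *ᵥ g)) hB 0
      simpa only [zero_dotProduct, phase_zero, one_smul, mulVec_zero, weyl_zero] using this }

/-- Moving `weyl p x` past `weyl p (G *ᵥ g)` costs a symplectic phase. In x = G(Kx) + H(Mx) the
first summand is invisible to this phase by isotropy; what remains is the character of `M *ᵥ x`,
which shifts the eigenvalue label. -/
theorem weyl_mul_eigenProj (hiso : Gᵀ * Matrix.J Q F * G = 0)
    (hGH : fromCols G H * fromRows K M = 1) (x : Q ⊕ Q → F) (s : R → F) :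
    weyl p x * eigenProj p (fun g => weyl p (G *ᵥ g)) (Gᵀ * Matrix.J Q F * H) s =
      eigenProj p (fun g => weyl p (G *ᵥ g)) (Gᵀ * Matrix.J Q F * H) (M *ᵥ x + s) *
        weyl p x := by
  have hsum : G * K + H * M = 1 := by rw [← hGH, fromCols_mul_fromRows]
  have hx : ∀ g : R → F, (G *ᵥ g) ⬝ᵥ (Matrix.J Q F) *ᵥ x =
      g ⬝ᵥ (Gᵀ * Matrix.J Q F * H) *ᵥ (M *ᵥ x) := by
    intro g
    have : x = G *ᵥ (K *ᵥ x) + H *ᵥ (M *ᵥ x) := by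
      rw [mulVec_mulVec, mulVec_mulVec, ← add_mulVec, hsum, one_mulVec]
    conv_lhs => rw [this]
    rw [mulVec_add, dotProduct_add, dotProduct_J_mulVec_eq_pairing,
      dotProduct_J_mulVec_eq_pairing, hiso, zero_mulVec, dotProduct_zero, zero_add]
  rw [eigenProj, eigenProj, Matrix.mul_smul, Matrix.smul_mul, Finset.mul_sum, Finset.sum_mul]
  congr 1
  refine Finset.sum_congr rfl fun g _ => ?_
  rw [Matrix.mul_smul, Matrix.smul_mul, weyl_mul_comm, sympPhase, smul_smul, ← phase_add,
    dotProduct_J_mulVec_neg_symm, hx, mulVec_add, dotProduct_add]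
  congr 2; ring

theorem transpose_mul_J_mul_self_eq_zero
    (hcss : ∀ g g' : R → F, ((G *ᵥ g) ∘ Sum.inr) ⬝ᵥ ((G *ᵥ g') ∘ Sum.inl) = 0) :
    Gᵀ * Matrix.J Q F * G = 0 := by
  ext r r'
  have h := dotProduct_J_mulVec_eq_pairing G G (Pi.single r 1) (Pi.single r' 1)
  rw [dotProduct_J_mulVec, hcss, hcss, sub_zero, mulVec_single_one, single_one_dotProduct] at h
  exact h.symm

/-- A maximal stabilizer of CSS type gives a sum box. -/
theorem exists_stabilizer_sumBox
    (hGH : fromCols G H * fromRows K M = 1) (hKM : fromRows K M * fromCols G H = 1)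
    (hcss : ∀ g g' : R → F, ((G *ᵥ g) ∘ Sum.inr) ⬝ᵥ ((G *ᵥ g') ∘ Sum.inl) = 0) :
    ∃ (ψ : (Q → F) → ℂ) (P : PVM (R → F) (Q → F)), ∑ j, ‖ψ j‖ ^ 2 = 1 ∧
      RealizesSumBox p ψ P M ∧ IsStabilizerBased p ψ P M ∧
      ∀ x y, outcomeProb P (weyl p x *ᵥ ψ) y ≠ 0 → y = M *ᵥ x := by
  have hiso := transpose_mul_J_mul_self_eq_zero hcss
  have hB := isUnit_pairing hiso hGH hKM
  set P := stabilizerPVM p hB hcss with hP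
  have hPproj : ∀ s, P.proj s =
    eigenProj p (fun g => weyl p (G *ᵥ g)) (Gᵀ * Matrix.J Q F * H) s := fun s => rfl
  have hcov : ∀ x s, weyl p x * P.proj s = P.proj (M *ᵥ x + s) * weyl p x := by
    intro x s
    rw [hPproj, hPproj, weyl_mul_eigenProj p hiso hGH]
  have hMH : M * H = 1 := by
    rw [fromRows_mul_fromCols, ← fromBlocks_one] at hKM
    exact (fromBlocks_inj.1 hKM).2.2.2
  -- Displacement by `H *ᵥ s` conjugates the projection at 0 into the one at `s`, so if the first
  -- vanished, all would, against completeness.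
  have hP0 : P.proj 0 ≠ 0 := by
    intro h0
    have hall : ∀ s, P.proj s = 0 := by
      intro s
      have h1 := hcov (H *ᵥ s) 0
      rw [mulVec_mulVec, hMH, one_mulVec, add_zero, h0, Matrix.mul_zero] at h1
      have h2 := mul_eq_one_comm.1 (weyl_conjTranspose_mul_self p (H *ᵥ s))
      rw [← Matrix.mul_one (P.proj s), ← h2, ← Matrix.mul_assoc, ← h1, Matrix.zero_mul]
    have h3 := P.complete
    simp only [hall, Finset.sum_const_zero] at h3
    exact zero_ne_one h3
  obtain ⟨φ, hφ⟩ : ∃ φ, P.proj 0 *ᵥ φ ≠ 0 := by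
    by_contra! h
    exact hP0 (Matrix.ext_of_mulVec_single fun i => by rw [h, zero_mulVec])
  have hnorm : ∀ χ : (Q → F) → ℂ, star χ ⬝ᵥ χ = ((∑ j, ‖χ j‖ ^ 2 : ℝ) : ℂ) := by
    intro χ
    simp only [dotProduct, Pi.star_apply, Complex.star_def, ← Complex.normSq_eq_conj_mul_self,
      Complex.normSq_eq_norm_sq]
    push_cast; rfl
  set χ := P.proj 0 *ᵥ φ with hχ
  set r : ℝ := ∑ j, ‖χ j‖ ^ 2 with hr
  have hrpos : 0 < r := by
    obtain ⟨j, hj⟩ := Function.ne_iff.mp hφ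
    refine Finset.sum_pos' (fun _ _ => sq_nonneg _) ⟨j, Finset.mem_univ _, ?_⟩
    exact pow_pos (norm_pos_iff.2 hj) 2
  set ψ : (Q → F) → ℂ := ((Real.sqrt r)⁻¹ : ℂ) • χ with hψ
  have hunit : ∑ j, ‖ψ j‖ ^ 2 = 1 := by
    simp only [hψ, Pi.smul_apply, smul_eq_mul, norm_mul, mul_pow]
    rw [← Finset.mul_sum, ← hr, norm_inv, Complex.norm_real, Real.norm_eq_abs,
      abs_of_nonneg (Real.sqrt_nonneg r), inv_pow, Real.sq_sqrt hrpos.le,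
      inv_mul_cancel₀ hrpos.ne']
  have hstab : P.proj 0 *ᵥ ψ = ψ := by
    rw [hψ, mulVec_smul, hχ, mulVec_mulVec, P.idempotent]
  have hfix : ∀ x, P.proj (M *ᵥ x) *ᵥ (weyl p x *ᵥ ψ) = weyl p x *ᵥ ψ := by
    intro x
    have := hcov x 0
    rw [add_zero] at this
    rw [mulVec_mulVec, ← this, ← mulVec_mulVec, hstab]
  refine ⟨ψ, P, hunit, ?_, ?_, ?_⟩
  · intro x
    rw [outcomeProb, hfix, star_mulVec, dotProduct_mulVec, vecMul_vecMul,
      weyl_conjTranspose_mul_self, vecMul_one, hnorm, hunit]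
    simp
  · refine ⟨G, H, K, fun _ => 1, hiso, hGH, hKM, fun _ => one_ne_zero, ?_, ?_, hstab⟩
    · intro g g'
      rw [one_smul, one_smul, one_smul, weyl_mul, hcss, phase_zero, one_smul, mulVec_add]
    · intro g
      simp only [one_smul, sympPhase]
      simp_rw [dotProduct_J_mulVec_eq_pairing, hPproj]
      exact (sum_phase_smul_eigenProj p (U := fun g => weyl p (G *ᵥ g)) hB g).symm
  · intro x y hy
    by_contra hne
    apply hy
    rw [outcomeProb, ← hfix x, mulVec_mulVec _ (P.proj y), P.orthogonal _ _ hne, zero_mulVec,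
      dotProduct_zero, Complex.zero_re]

end Stabilizer

/-! ### Cauchy-Vandermonde matrices and GRS duality -/

section CodeMatrix

open Matrix Polynomial

variable {F : Type u} [Field F]

theorem qcsaMatrix_mulVec {L d : ℕ} (α β : Fin (L + d) → F) (f : Fin L → F)
    (x : Fin (L + d) → F) (k : Fin (L + d)) :
    (qcsaMatrix α β f *ᵥ x) k = β k * (∑ l, x (Fin.castAdd d l) / (f l - α k) +
      ∑ m, x (Fin.natAdd L m) * α k ^ m.val) := by
  simp only [mulVec, dotProduct, Fin.sum_univ_add, qcsaMatrix, Matrix.of_apply, mul_add,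
    Finset.mul_sum]
  congr 1
  · refine Finset.sum_congr rfl fun l _ => ?_
    have : (Fin.castAdd d l).val < L := l.2
    rw [dif_pos this]
    simp only [Fin.val_castAdd, Fin.eta]
    ring
  · refine Finset.sum_congr rfl fun m _ => ?_
    rw [dif_neg (by simp)]
    simp only [Fin.val_natAdd, Nat.add_sub_cancel_left]
    ring

theorem natDegree_prod_C_sub_X_le {ι : Type*} (s : Finset ι) (f : ι → F) :
    (∏ i ∈ s, (C (f i) - X)).natDegree ≤ s.card := by
  refine (natDegree_prod_le s _).trans ?_
  refine (Finset.sum_le_card_nsmul s _ 1 fun i _ => ?_).trans (by simp)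
  refine (natDegree_sub_le _ _).trans ?_
  simp

/-- Clearing the denominators turns a kernel vector into a polynomial A + WV of degree below L + d
vanishing at the L + d points `α k`, hence zero. Its values at the `f l` isolate the Cauchy
coefficients; then V = 0 gives the Vandermonde ones. -/
theorem eq_zero_of_qcsaMatrix_mulVec_eq_zero {L d : ℕ} {α β : Fin (L + d) → F} {f : Fin L → F}
    (hinj : Function.Injective (Sum.elim α f)) (hβ : ∀ k, β k ≠ 0) {x : Fin (L + d) → F}
    (hx : qcsaMatrix α β f *ᵥ x = 0) : x = 0 := by
  have hα : Function.Injective α := fun a b h => Sum.inl_injective (hinj h)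
  have hf : Function.Injective f := fun a b h => Sum.inr_injective (hinj h)
  have hfα : ∀ l k, f l - α k ≠ 0 := fun l k h =>
    Sum.inr_ne_inl (hinj (show Sum.elim α f (Sum.inr l) = Sum.elim α f (Sum.inl k) from
      sub_eq_zero.1 h))
  set A : F[X] := ∑ l, C (x (Fin.castAdd d l)) * ∏ l' ∈ Finset.univ.erase l, (C (f l') - X)
    with hA
  set V : F[X] := ∑ m : Fin d, C (x (Fin.natAdd L m)) * X ^ m.val with hV
  set W : F[X] := ∏ l, (C (f l) - X) with hW
  have hdegA : A ∈ degreeLT F (L + d) := by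
    refine Submodule.sum_mem _ fun l _ => mem_degreeLT.2 ?_
    refine lt_of_le_of_lt (degree_le_of_natDegree_le ((natDegree_C_mul_le _ _).trans
      (natDegree_prod_C_sub_X_le _ _))) ?_
    rw [Finset.card_erase_of_mem (Finset.mem_univ l), Finset.card_univ, Fintype.card_fin]
    have := l.2
    exact_mod_cast (by omega : L - 1 < L + d)
  have hdegW : W * V ∈ degreeLT F (L + d) := by
    rw [hV, Finset.mul_sum]
    refine Submodule.sum_mem _ fun m _ => mem_degreeLT.2 ?_
    have hWdeg : W.natDegree ≤ L := by
      simpa using natDegree_prod_C_sub_X_le Finset.univ f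
    refine lt_of_le_of_lt (degree_le_of_natDegree_le (natDegree_mul_le.trans
      (add_le_add hWdeg (natDegree_C_mul_X_pow_le _ _)))) ?_
    have := m.2
    exact_mod_cast (by omega : L + m.val < L + d)
  have hzero : A + W * V = 0 := by
    refine eq_zero_of_degree_lt_of_eval_index_eq_zero (s := Finset.univ) (v := α)
      hα.injOn ?_ ?_
    · simpa using mem_degreeLT.1 (Submodule.add_mem _ hdegA hdegW)
    · intro k _
      have hk := congrFun hx k
      rw [qcsaMatrix_mulVec, Pi.zero_apply] at hk
      replace hk := (mul_eq_zero.1 hk).resolve_left (hβ k)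
      have h1 : A.eval (α k) = W.eval (α k) * ∑ l, x (Fin.castAdd d l) / (f l - α k) := by
        simp only [hA, hW, eval_finsetSum, eval_mul, eval_C, eval_prod, eval_sub, eval_X,
          Finset.mul_sum]
        refine Finset.sum_congr rfl fun l _ => ?_
        rw [← Finset.mul_prod_erase Finset.univ _ (Finset.mem_univ l)]
        field_simp [hfα l k]
      have h2 : V.eval (α k) = ∑ m, x (Fin.natAdd L m) * α k ^ m.val := by
        simp [hV, eval_finsetSum]
      rw [eval_add, eval_mul, h1, h2, ← mul_add, hk, mul_zero]
  have hxl : ∀ l, x (Fin.castAdd d l) = 0 := by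
    intro l
    have h := congrArg (eval (f l)) hzero
    have hWl : W.eval (f l) = 0 := by
      rw [hW, eval_prod]
      exact Finset.prod_eq_zero (Finset.mem_univ l) (by simp)
    rw [eval_add, eval_mul, hWl, zero_mul, add_zero, eval_zero, hA, eval_finsetSum,
      Finset.sum_eq_single l] at h
    · rw [eval_mul, eval_C] at h
      refine (mul_eq_zero.1 h).resolve_right ?_
      rw [eval_prod]
      refine Finset.prod_ne_zero_iff.2 fun l' hl' => ?_
      rw [eval_sub, eval_C, eval_X, sub_ne_zero]
      exact fun h' => (Finset.mem_erase.1 hl').1 (hf h')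
    · intro l' _ hl'
      rw [eval_mul, eval_prod, Finset.prod_eq_zero (i := l), mul_zero]
      · exact Finset.mem_erase.2 ⟨hl'.symm, Finset.mem_univ l⟩
      · simp
    · simp
  have hA0 : A = 0 := by simp [hA, hxl]
  have hV0 : V = 0 := by
    rw [hA0, zero_add] at hzero
    refine (mul_eq_zero.1 hzero).resolve_left (Finset.prod_ne_zero_iff.2 fun l _ => ?_)
    exact sub_ne_zero.2 fun h => X_ne_C (f l) h.symm
  funext c
  induction c using Fin.addCases with
  | left l => exact hxl l
  | right m =>
    have h := congrArg (fun P : F[X] => P.coeff m.val) hV0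
    simpa [hV, finsetSum_coeff, coeff_C_mul, coeff_X_pow, Fin.val_inj] using h

theorem isUnit_qcsaMatrix {n L : ℕ} (hL : L ≤ n) {α β : Fin n → F} {f : Fin L → F}
    (hinj : Function.Injective (Sum.elim α f)) (hβ : ∀ k, β k ≠ 0) :
    IsUnit (qcsaMatrix α β f) := by
  obtain ⟨d, rfl⟩ := Nat.exists_eq_add_of_le hL
  rw [← Matrix.mulVec_injective_iff_isUnit]
  intro x y hxy
  refine sub_eq_zero.1 (eq_zero_of_qcsaMatrix_mulVec_eq_zero hinj hβ ?_)
  rw [mulVec_sub, sub_eq_zero]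
  exact hxy

theorem dualMultiplier_ne_zero {n : ℕ} {α u : Fin n → F} (hα : Function.Injective α)
    (hu : ∀ k, u k ≠ 0) (k : Fin n) : dualMultiplier α u k ≠ 0 := by
  refine mul_ne_zero (inv_ne_zero (hu k)) (inv_ne_zero (Finset.prod_ne_zero_iff.2 ?_))
  intro i hi
  exact sub_ne_zero.2 fun h => (Finset.mem_erase.1 hi).1 (hα h).symm

/-- Orthogonality of a generalized Reed-Solomon code and its dual. -/
theorem sum_dualMultiplier_mul_pow {n a b : ℕ} {α u : Fin n → F} (hα : Function.Injective α)
    (hu : ∀ k, u k ≠ 0) (hab : a + b + 1 < n) :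
    ∑ k, (dualMultiplier α u k * α k ^ a) * (u k * α k ^ b) = 0 := by
  -- The sum is the top coefficient, in degree n - 1, of the interpolant of X^(a+b) at the n nodes;
  -- it vanishes since a + b < n - 1.
  have h := Lagrange.coeff_eq_sum (s := Finset.univ) hα.injOn (P := (X : F[X]) ^ (a + b))
    (by rw [degree_X_pow, Finset.card_univ, Fintype.card_fin]
        exact_mod_cast (by omega : a + b < n))
  rw [Finset.card_univ, Fintype.card_fin, coeff_X_pow, if_neg (by omega)] at h
  rw [h]
  refine Finset.sum_congr rfl fun k _ => ?_
  have := hu k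
  rw [dualMultiplier, eval_pow, eval_X, div_eq_mul_inv, pow_add]
  field_simp

end CodeMatrix

/-! ### The QCSA transfer matrix -/

section Transfer

open Matrix

variable {F : Type u} [Field F] {n L : ℕ}

/-- The columns kept by `selection`. -/
def keptColumn (h : 2 * L ≤ n) : BoxOutput n L → Fin n ⊕ Fin n
  | Sum.inl (Sum.inl l) => Sum.inl ⟨l, by omega⟩
  | Sum.inl (Sum.inr m) => Sum.inl ⟨L + (n + 1) / 2 + m, by omega⟩
  | Sum.inr (Sum.inl l) => Sum.inr ⟨l, by omega⟩
  | Sum.inr (Sum.inr m) => Sum.inr ⟨L + n / 2 + m, by omega⟩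

/-- The columns discarded by `selection`, which span the stabilizer. -/
def droppedColumn (h : 2 * L ≤ n) : BoxOutput n L → Fin n ⊕ Fin n
  | Sum.inl (Sum.inl l) => Sum.inr ⟨L + l, by omega⟩
  | Sum.inl (Sum.inr m) => Sum.inr ⟨L + L + m, by omega⟩
  | Sum.inr (Sum.inl l) => Sum.inl ⟨L + l, by omega⟩
  | Sum.inr (Sum.inr m) => Sum.inl ⟨L + L + m, by omega⟩

/-- The labels are crossed: the ⌊n/2⌋ labels of the first instance index dropped columns of the
second block, and the ⌈n/2⌉ labels of the second those of the first. This lets one label type serve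
stabilizer and syndrome also for odd n. -/
theorem bijective_droppedColumn_keptColumn (h : 2 * L ≤ n) :
    Function.Bijective (Sum.elim (droppedColumn h) (keptColumn h)) := by
  rw [Fintype.bijective_iff_injective_and_card]
  constructor
  · rintro (((a | a) | (a | a)) | ((a | a) | (a | a)))
      (((b | b) | (b | b)) | ((b | b) | (b | b))) hab <;>
    simp only [Sum.elim_inl, Sum.elim_inr, droppedColumn, keptColumn, Sum.inl.injEq,
      Sum.inr.injEq, Fin.ext_iff, reduceCtorEq] at hab ⊢ <;> omega
  · simp only [Fintype.card_sum, Fintype.card_fin]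
    omega

theorem selection_mul_apply (h : 2 * L ≤ n) {m : Type*}
    (A : Matrix (Fin n ⊕ Fin n) m F) (r : BoxOutput n L) (j : m) :
    (selection F n L * A) r j = A (keptColumn h r) j := by
  have hsel : ∀ c, selection F n L r c = if keptColumn h r = c then 1 else 0 := by
    intro c
    rcases r with (l | l) | (l | l) <;> rcases c with c | c <;>
      simp [selection, keptColumn, Fin.ext_iff, eq_comm]
  rw [Matrix.mul_apply]
  simp [hsel]

theorem isUnit_det_fromBlocks_qcsaMatrix (h : 2 * L ≤ n) {α u : Fin n → F} {f : Fin L → F}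
    (hinj : Function.Injective (Sum.elim α f)) (hu : ∀ k, u k ≠ 0) :
    IsUnit (Matrix.fromBlocks (qcsaMatrix α u f) 0 0
      (qcsaMatrix α (dualMultiplier α u) f)).det := by
  have hα : Function.Injective α := fun a b h => Sum.inl_injective (hinj h)
  rw [Matrix.det_fromBlocks_zero₂₁]
  exact ((Matrix.isUnit_iff_isUnit_det _).1 (isUnit_qcsaMatrix (by omega) hinj hu)).mul
    ((Matrix.isUnit_iff_isUnit_det _).1
      (isUnit_qcsaMatrix (by omega) hinj (dualMultiplier_ne_zero hα hu)))

/-- The stabilizer-based sum box with the QCSA transfer matrix. -/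
theorem exists_qcsa_sumBox (p : ℕ) [Fact p.Prime] [Fintype F] [DecidableEq F]
    [Algebra (ZMod p) F] (h : 2 * L ≤ n) {α u : Fin n → F} {f : Fin L → F}
    (hinj : Function.Injective (Sum.elim α f)) (hu : ∀ k, u k ≠ 0) :
    ∃ (ψ : (Fin n → F) → ℂ) (P : PVM (BoxOutput n L → F) (Fin n → F)),
      ∑ j, ‖ψ j‖ ^ 2 = 1 ∧ RealizesSumBox p ψ P (qcsaTransfer α u f) ∧
      IsStabilizerBased p ψ P (qcsaTransfer α u f) ∧
      ∀ x y, outcomeProb P (weyl p x *ᵥ ψ) y ≠ 0 → y = qcsaTransfer α u f *ᵥ x := by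
  have hα : Function.Injective α := fun a b h => Sum.inl_injective (hinj h)
  set D := Matrix.fromBlocks (qcsaMatrix α u f) 0 0 (qcsaMatrix α (dualMultiplier α u) f)
    with hD
  have hDunit : IsUnit D.det := isUnit_det_fromBlocks_qcsaMatrix h hinj hu
  -- `(G H)` is `D` with permuted columns and its candidate inverse is `D⁻¹` with rows permuted
  -- alike.
  let e := Equiv.ofBijective _ (bijective_droppedColumn_keptColumn h)
  have hcols : fromCols (D.submatrix id (droppedColumn h)) (D.submatrix id (keptColumn h)) =
      D.submatrix (Equiv.refl _) e := by
    ext i (j | j) <;> rfl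
  have hrows : fromRows (D⁻¹.submatrix (droppedColumn h) id) (qcsaTransfer α u f) =
      D⁻¹.submatrix e (Equiv.refl _) := by
    ext (i | i) j
    · rfl
    · exact selection_mul_apply h _ i j
  refine exists_stabilizer_sumBox p (G := D.submatrix id (droppedColumn h))
    (H := D.submatrix id (keptColumn h)) (K := D⁻¹.submatrix (droppedColumn h) id) ?_ ?_ ?_
  · rw [hcols, hrows, submatrix_mul_equiv, Matrix.mul_nonsing_inv _ hDunit]
    exact submatrix_one_equiv _
  · rw [hcols, hrows, submatrix_mul_equiv, Matrix.nonsing_inv_mul _ hDunit]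
    exact submatrix_one_equiv _
  -- Only a v-column against a u-column is not trivially orthogonal; their exponents are below ⌊n/2⌋
  -- and ⌈n/2⌉, so they sum to at most n - 2.
  · have hmat : ((D.submatrix id (droppedColumn h)).submatrix Sum.inr id)ᵀ *
        (D.submatrix id (droppedColumn h)).submatrix Sum.inl id = 0 := by
      ext r r'
      rw [Matrix.mul_apply]
      rcases r with (l | l) | (l | l) <;> rcases r' with (l' | l') | (l' | l') <;>
        simp only [transpose_apply, submatrix_apply, droppedColumn, id, hD, fromBlocks_apply₁₁,
          fromBlocks_apply₁₂, fromBlocks_apply₂₁, fromBlocks_apply₂₂, Matrix.zero_apply,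
          mul_zero, zero_mul, Finset.sum_const_zero]
      all_goals
        simp only [qcsaMatrix, Matrix.of_apply]
        simp (disch := omega) only [dif_neg]
        exact sum_dualMultiplier_mul_pow hα hu (by omega)
    intro g g'
    have := congrArg (fun B => g ⬝ᵥ B *ᵥ g') hmat
    simp only [zero_mulVec, dotProduct_zero, ← mulVec_mulVec] at this
    rw [dotProduct_mulVec g, vecMul_transpose] at this
    exact this

/-- On the answers of two CSA instances, scaled by `u` and `v`, the box outputs the desired
symbols. -/
theorem qcsaTransfer_mulVec_desiredOutput (h : 2 * L ≤ n) {α u : Fin n → F} {f : Fin L → F}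
    (hinj : Function.Injective (Sum.elim α f)) (hu : ∀ k, u k ≠ 0) (x : Fin 2 → Fin n → F)
    (b : Fin 2) (l : Fin L) :
    (qcsaTransfer α u f *ᵥ Sum.elim (fun k => u k * (csaMatrix α f *ᵥ x 0) k)
      (fun k => dualMultiplier α u k * (csaMatrix α f *ᵥ x 1) k)) (desiredOutput b l) =
      x b ⟨l, by omega⟩ := by
  set D := Matrix.fromBlocks (qcsaMatrix α u f) 0 0 (qcsaMatrix α (dualMultiplier α u) f)
    with hD
  have hDunit : IsUnit D.det := isUnit_det_fromBlocks_qcsaMatrix h hinj hu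
  -- Scaling the answers by β multiplies the rows of the CSA matrix, so the box input is `D` applied
  -- to both symbol vectors and `D⁻¹` recovers them.
  have hscale : ∀ (β : Fin n → F) (y : Fin n → F),
      (fun k => β k * (csaMatrix α f *ᵥ y) k) = qcsaMatrix α β f *ᵥ y := by
    intro β y
    funext k
    simp only [mulVec, dotProduct, Finset.mul_sum, csaMatrix, qcsaMatrix, Matrix.of_apply]
    refine Finset.sum_congr rfl fun c _ => ?_
    split_ifs <;> ring
  have hin : Sum.elim (fun k => u k * (csaMatrix α f *ᵥ x 0) k)
      (fun k => dualMultiplier α u k * (csaMatrix α f *ᵥ x 1) k) =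
      D *ᵥ Sum.elim (x 0) (x 1) := by
    rw [hscale, hscale, hD, fromBlocks_mulVec]
    simp
  have hsel : ∀ y : Fin n ⊕ Fin n → F, ∀ r, (selection F n L *ᵥ y) r = y (keptColumn h r) := by
    intro y r
    have := selection_mul_apply h (Matrix.replicateCol Unit y) r ()
    rwa [← replicateCol_mulVec] at this
  rw [hin, qcsaTransfer, ← hD, mulVec_mulVec, Matrix.mul_assoc, Matrix.nonsing_inv_mul _ hDunit,
    Matrix.mul_one, hsel]
  fin_cases b <;> rfl

end Transfer

/-! ### Secret sharing and cross-subspace alignment -/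

section Masking

open Polynomial

variable {F : Type u} [Field F] {N n L X : ℕ} {ι : Type} {r c : ℕ}

/-- The share of server `m`: every matrix `A i` is masked by a noise polynomial in
`f_l - α_m` without constant term, where `l = loc i`. Servers beyond the first `n` get an empty
share. -/
def maskedShare (α : Fin n → F) (f : Fin L → F) (loc : ι → Fin L) (m : Fin N)
    (A : ι → Matrix (Fin r) (Fin c) F) (z : ι → Fin X → Matrix (Fin r) (Fin c) F) :
    ι → Matrix (Fin r) (Fin c) F :=
  fun i => if h : m.val < n then
    A i + ∑ x, (f (loc i) - α ⟨m, h⟩) ^ (x.val + 1) • z i x else 0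

/-- After division by δ this is interpolation of a/δ at no more than `X` nonzero nodes by a
polynomial of degree below `X`. -/
theorem exists_sum_pow_mul_eq [DecidableEq F] (C : Finset F) (hC : C.card ≤ X)
    (h0 : ∀ δ ∈ C, δ ≠ 0) (a : F) :
    ∃ z : Fin X → F, ∀ δ ∈ C, ∑ x, δ ^ (x.val + 1) * z x = a := by
  set P := Lagrange.interpolate C id (fun δ => a / δ) with hP
  have hinj : Set.InjOn (id : F → F) C := Function.injective_id.injOn
  have hdeg : P.degree < X :=
    (Lagrange.degree_interpolate_lt _ hinj).trans_le (by exact_mod_cast hC)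
  refine ⟨fun x => P.coeff x, fun δ hδ => ?_⟩
  have h1 : P.eval δ = a / δ := Lagrange.eval_interpolate_at_node _ hinj hδ
  rw [eval_eq_sum, ← sum_fin (fun i b => b * δ ^ i) (by simp) hdeg] at h1
  calc ∑ x : Fin X, δ ^ (x.val + 1) * P.coeff x
      = δ * ∑ x : Fin X, P.coeff x * δ ^ x.val := by
        rw [Finset.mul_sum]
        exact Finset.sum_congr rfl fun x _ => by ring
    _ = a := by rw [h1, mul_div_cancel₀ _ (h0 δ hδ)]

/-- The shift need only produce `A' - A` at the evaluation points of the servers in `C`, entry by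
entry; as `z₀` does not depend on `z`, it transports the uniform law. -/
theorem exists_maskedShare_shift [DecidableEq F] {α : Fin n → F} {f : Fin L → F}
    (hinj : Function.Injective (Sum.elim α f)) (loc : ι → Fin L) (C : Finset (Fin N))
    (hC : C.card ≤ X) (A A' : ι → Matrix (Fin r) (Fin c) F) :
    ∃ z₀ : ι → Fin X → Matrix (Fin r) (Fin c) F, ∀ m ∈ C, ∀ z,
      maskedShare α f loc m A (z + z₀) = maskedShare α f loc m A' z := by
  have hex : ∀ i a b, ∃ z : Fin X → F, ∀ m ∈ C, ∀ h : m.val < n,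
      ∑ x, (f (loc i) - α ⟨m, h⟩) ^ (x.val + 1) * z x = A' i a b - A i a b := by
    intro i a b
    obtain ⟨z, hz⟩ := exists_sum_pow_mul_eq (X := X)
      -- The value 0 stands for inactive servers and is erased; the points of active servers are
      -- nonzero.
      ((C.image fun m : Fin N => if h : m.val < n then f (loc i) - α ⟨m, h⟩ else 0).erase 0)
      ((Finset.card_erase_le.trans Finset.card_image_le).trans hC)
      (fun δ hδ => (Finset.mem_erase.1 hδ).1) (A' i a b - A i a b)
    refine ⟨z, fun m hm h => hz _ (Finset.mem_erase.2 ⟨?_, Finset.mem_image.2 ⟨m, hm, ?_⟩⟩)⟩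
    · exact fun h' => Sum.inr_ne_inl (hinj (show Sum.elim α f (Sum.inr (loc i)) =
        Sum.elim α f (Sum.inl ⟨m, h⟩) from sub_eq_zero.1 h'))
    · rw [dif_pos h]
  choose z₀ hz₀ using hex
  refine ⟨fun i x => Matrix.of fun a b => z₀ i a b x, fun m hm z => ?_⟩
  funext i
  unfold maskedShare
  split_ifs with h
  · ext a b
    simp only [Pi.add_apply, smul_add, Finset.sum_add_distrib, Matrix.add_apply,
      Matrix.sum_apply, Matrix.smul_apply, Matrix.of_apply, smul_eq_mul]
    rw [hz₀ i a b m hm h]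
    ring
  · rfl

theorem map_add_right_uniformOfFintype {Z : Type*} [AddGroup Z] [Fintype Z] (z₀ : Z) :
    (PMF.uniformOfFintype Z).map (· + z₀) = PMF.uniformOfFintype Z := by
  classical
  ext b
  rw [PMF.map_apply, tsum_eq_single (b - z₀)]
  · simp
  · intro z hz
    rw [if_neg]
    rintro rfl
    simp at hz

/-- The masked shares of at most `X` servers have a law that does not depend on the matrices. -/
theorem map_maskedShare_eq [Fintype F] [DecidableEq F] [Fintype ι] [DecidableEq ι]
    {α : Fin n → F} {f : Fin L → F}
    (hinj : Function.Injective (Sum.elim α f)) (loc : ι → Fin L) (C : Finset (Fin N))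
    (hC : C.card ≤ X) (A A' : ι → Matrix (Fin r) (Fin c) F) :
    (PMF.uniformOfFintype (ι → Fin X → Matrix (Fin r) (Fin c) F)).map
        (fun z (m : C) => maskedShare α f loc m.val A z) =
      (PMF.uniformOfFintype (ι → Fin X → Matrix (Fin r) (Fin c) F)).map
        (fun z (m : C) => maskedShare α f loc m.val A' z) := by
  obtain ⟨z₀, hz₀⟩ := exists_maskedShare_shift (X := X) hinj loc C hC A A'
  conv_lhs => rw [← map_add_right_uniformOfFintype z₀, PMF.map_comp]
  congr 1
  funext z m
  exact hz₀ m.val m.2 z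

/-- The polynomial whose value at `f_l - α_m` is an entry of a masked share. -/
def maskPoly (a : F) (z : Fin X → F) : F[X] :=
  C a + ∑ x, C (z x) * Polynomial.X ^ (x.val + 1)

theorem natDegree_maskPoly_le (a : F) (z : Fin X → F) : (maskPoly a z).natDegree ≤ X := by
  refine natDegree_add_le_of_degree_le (by simp) (natDegree_sum_le_of_forall_le _ _ fun x _ => ?_)
  exact (natDegree_C_mul_X_pow_le _ _).trans x.2

theorem coeff_zero_maskPoly (a : F) (z : Fin X → F) : (maskPoly a z).coeff 0 = a := by
  simp [maskPoly, finsetSum_coeff]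

theorem eval_maskPoly (a : F) (z : Fin X → F) (δ : F) :
    (maskPoly a z).eval δ = a + ∑ x, δ ^ (x.val + 1) * z x := by
  simp only [maskPoly, eval_add, eval_C, eval_finsetSum, eval_mul, eval_pow, eval_X,
    mul_comm (z _)]

/-- The alignment step: only the constant coefficient keeps a pole at δ = 0, everything else stays
polynomial. -/
theorem eval_divX_add_coeff_zero_div (P : F[X]) {δ : F} (hδ : δ ≠ 0) :
    P.eval δ * δ⁻¹ = P.coeff 0 / δ + P.divX.eval δ := by
  conv_lhs => rw [← divX_mul_X_add P]
  rw [eval_add, eval_mul, eval_X, eval_C]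
  field_simp
  ring

/-- The answers of the servers are a codeword of the cross-subspace alignment code. -/
theorem exists_csaMatrix_mulVec_eq {d XA XB eta : ℕ} (hd0 : 0 < d) (hd : XA + XB ≤ d)
    {α : Fin (L + d) → F} {f : Fin L → F} (hinj : Function.Injective (Sum.elim α f))
    (a b : Fin L → Fin eta → F) (za : Fin L → Fin eta → Fin XA → F)
    (zb : Fin L → Fin eta → Fin XB → F) :
    ∃ x : Fin (L + d) → F,
      (∀ (l : Fin L) (c : Fin (L + d)), c.val = l.val → x c = ∑ e, a l e * b l e) ∧
      (fun k => ∑ l, (f l - α k)⁻¹ * ∑ e,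
        (a l e + ∑ x, (f l - α k) ^ (x.val + 1) * za l e x) *
        (b l e + ∑ x, (f l - α k) ^ (x.val + 1) * zb l e x)) =
        (csaMatrix α f).mulVec x := by
  have hfα : ∀ l k, f l - α k ≠ 0 := fun l k h =>
    Sum.inr_ne_inl (hinj (show Sum.elim α f (Sum.inr l) = Sum.elim α f (Sum.inl k) from
      sub_eq_zero.1 h))
  set P : Fin L → F[X] := fun l => ∑ e, maskPoly (a l e) (za l e) * maskPoly (b l e) (zb l e)
    with hP
  have hPdeg : ∀ l, (P l).natDegree ≤ XA + XB := fun l =>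
    natDegree_sum_le_of_forall_le _ _ fun e _ => natDegree_mul_le.trans
      (add_le_add (natDegree_maskPoly_le _ _) (natDegree_maskPoly_le _ _))
  have hP0 : ∀ l, (P l).coeff 0 = ∑ e, a l e * b l e := by
    intro l
    simp [hP, finsetSum_coeff, mul_coeff_zero, coeff_zero_maskPoly]
  set I : F[X] := ∑ l, (P l).divX.comp (C (f l) - Polynomial.X) with hI
  have hIdeg : I.natDegree < d := by
    -- The subtraction truncates: without security the bound is 0 and one interference column is
    -- still present, whence `0 < d`.
    have : I.natDegree ≤ XA + XB - 1 := by
      refine natDegree_sum_le_of_forall_le _ _ fun l _ => natDegree_comp_le.trans ?_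
      have h1 : (C (f l) - Polynomial.X : F[X]).natDegree ≤ 1 :=
        (natDegree_sub_le _ _).trans (by simp)
      have h2 := hPdeg l
      rw [natDegree_divX_eq_natDegree_tsub_one]
      exact (Nat.mul_le_mul_left _ h1).trans (by omega)
    omega
  refine ⟨Fin.addCases (fun l => ∑ e, a l e * b l e) (fun m => I.coeff m), ?_, ?_⟩
  · intro l c hc
    have : c = Fin.castAdd d l := Fin.ext hc
    simp only [this, Fin.addCases_left]
  · funext k
    rw [csaMatrix, qcsaMatrix_mulVec, one_mul]
    simp only [Fin.addCases_left, Fin.addCases_right]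
    have hIk : ∑ m : Fin d, I.coeff m * α k ^ m.val = I.eval (α k) := by
      rw [eval_eq_sum_range' hIdeg, Finset.sum_range]
    rw [hIk, hI, eval_finsetSum, ← Finset.sum_add_distrib]
    refine Finset.sum_congr rfl fun l _ => ?_
    have h1 := eval_divX_add_coeff_zero_div (P l) (hfα l k)
    rw [hP0] at h1
    rw [eval_comp, eval_sub, eval_C, eval_X, ← h1, mul_comm]
    simp only [hP, eval_finsetSum, eval_mul, eval_maskPoly]

end Masking

/-! ### The scheme, its security and its correctness -/

section SchemeConstruction

variable {F : Type u} [Field F] [Fintype F] [DecidableEq F] {N L d : ℕ}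

/-- The answer of a server: the sum of the products of its shares with weights
`1 / (f_l - α_k)`. -/
def csaAnswer {T lam eta mu : ℕ} (α : Fin (L + d) → F) (f : Fin L → F)
    (c : Fin T × Fin lam × Fin mu) (b : Fin 2) (k : Fin (L + d))
    (sA : Fin T × Fin 2 × Fin L → Matrix (Fin lam) (Fin eta) F)
    (sB : Fin T × Fin 2 × Fin L → Matrix (Fin eta) (Fin mu) F) : F :=
  ∑ l, (f l - α k)⁻¹ * (sA (c.1, b, l) * sB (c.1, b, l)) c.2.1 c.2.2

/-- The QCSA scheme with code parameters `α`, `u`, `f` on the sum box given by `ψ` and `P`. -/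
def qcsaScheme (T XA XB lam eta mu : ℕ) (hN : L + d ≤ N) (α u : Fin (L + d) → F)
    (f : Fin L → F) (ψ : (Fin (L + d) → F) → ℂ) (hψ : ∑ j, ‖ψ j‖ ^ 2 = 1)
    (P : PVM (BoxOutput (L + d) L → F) (Fin (L + d) → F)) :
    Scheme F N (Fin T × Fin 2 × Fin L) (Fin T × Fin lam × Fin mu) (Fin (L + d))
      (BoxOutput (L + d) L → F) lam eta mu where
  NoiseA := Fin T × Fin 2 × Fin L → Fin XA → Matrix (Fin lam) (Fin eta) F
  NoiseB := Fin T × Fin 2 × Fin L → Fin XB → Matrix (Fin eta) (Fin mu) F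
  ShareA := Fin T × Fin 2 × Fin L → Matrix (Fin lam) (Fin eta) F
  ShareB := Fin T × Fin 2 × Fin L → Matrix (Fin eta) (Fin mu) F
  noiseA := PMF.uniformOfFintype _
  noiseB := PMF.uniformOfFintype _
  encA := maskedShare α f (fun i => i.2.2)
  encB := maskedShare α f (fun i => i.2.2)
  owner := Fin.castLE hN
  state := fun _ => ψ
  state_unit := fun _ => hψ
  gateInput := fun c k sA sB =>
    (u k * csaAnswer α f c 0 k sA sB, dualMultiplier α u k * csaAnswer α f c 1 k sA sB)
  measurement := fun _ => P
  decode := fun y i => Matrix.of fun a b => y (i.1, a, b) (desiredOutput i.2.1 i.2.2)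

theorem exists_csaAnswer_eq {T XA XB lam eta mu : ℕ} (hd0 : 0 < d) (hd : XA + XB ≤ d)
    (hN : L + d ≤ N) {α : Fin (L + d) → F} {f : Fin L → F}
    (hinj : Function.Injective (Sum.elim α f))
    (A : Fin T × Fin 2 × Fin L → Matrix (Fin lam) (Fin eta) F)
    (B : Fin T × Fin 2 × Fin L → Matrix (Fin eta) (Fin mu) F)
    (zA : Fin T × Fin 2 × Fin L → Fin XA → Matrix (Fin lam) (Fin eta) F)
    (zB : Fin T × Fin 2 × Fin L → Fin XB → Matrix (Fin eta) (Fin mu) F)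
    (t : Fin T) (i : Fin lam) (j : Fin mu) (b : Fin 2) :
    ∃ x : Fin (L + d) → F,
      (∀ (l : Fin L) (c : Fin (L + d)), c.val = l.val →
        x c = (A (t, b, l) * B (t, b, l)) i j) ∧
      (fun k => csaAnswer α f (t, i, j) b k
        (maskedShare α f (fun i => i.2.2) (Fin.castLE hN k) A zA)
        (maskedShare α f (fun i => i.2.2) (Fin.castLE hN k) B zB)) =
        (csaMatrix α f).mulVec x := by
  obtain ⟨x, hx, hx'⟩ := exists_csaMatrix_mulVec_eq hd0 hd hinj
    (fun l e => A (t, b, l) i e) (fun l e => B (t, b, l) e j)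
    (fun l e x => zA (t, b, l) x i e) (fun l e x => zB (t, b, l) x e j)
  refine ⟨x, hx, ?_⟩
  rw [← hx']
  funext k
  refine Finset.sum_congr rfl fun l _ => ?_
  simp [maskedShare, Matrix.mul_apply, Matrix.sum_apply]

/-- A QCSA scheme on `L + d` servers with security `XA`, `XB` and zero error. -/
theorem exists_qcsa_scheme (p : ℕ) [Fact p.Prime] [Algebra (ZMod p) F]
    (T XA XB lam eta mu : ℕ) (hLd : L ≤ d) (hd0 : 0 < d) (hd : XA + XB ≤ d) (hN : L + d ≤ N)
    (hq : L + d + L ≤ Fintype.card F) :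
    ∃ S : Scheme F N (Fin T × Fin 2 × Fin L) (Fin T × Fin lam × Fin mu) (Fin (L + d))
      (BoxOutput (L + d) L → F) lam eta mu,
      IsQCSA p S ∧ S.SecureA XA ∧ S.SecureB XB ∧ S.Correct p := by
  -- The bound on the field size supplies the n + L distinct points; `u` may be any nonvanishing
  -- vector.
  obtain ⟨emb⟩ : Nonempty (Fin (L + d) ⊕ Fin L ↪ F) :=
    Function.Embedding.nonempty_of_card_le (by simpa using hq)
  set α : Fin (L + d) → F := fun k => emb (Sum.inl k) with hα
  set f : Fin L → F := fun l => emb (Sum.inr l) with hf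
  have hinj : Function.Injective (Sum.elim α f) := by
    have : Sum.elim α f = emb := by ext (x | x) <;> rfl
    rw [this]
    exact emb.injective
  have h2 : 2 * L ≤ L + d := by omega
  set u : Fin (L + d) → F := fun _ => 1 with hu_def
  have hu : ∀ k, u k ≠ 0 := fun _ => one_ne_zero
  obtain ⟨ψ, P, hψ, hbox, hstab, hout⟩ := exists_qcsa_sumBox p h2 hinj hu
  refine ⟨qcsaScheme T XA XB lam eta mu hN α u f ψ hψ P, ⟨h2, Fin.castLE_injective hN, α, u, f,
    csaAnswer α f, hinj, hu, ?_, fun _ _ _ _ => rfl, fun _ => ⟨hbox, hstab⟩,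
    fun _ _ _ _ _ _ => rfl⟩, ?_, ?_, ?_⟩
  · intro A B zA _ zB _ t i j b
    exact exists_csaAnswer_eq hd0 hd hN hinj A B zA zB t i j b
  · intro C hC A A'
    exact map_maskedShare_eq hinj _ C hC A A'
  · intro C hC B B'
    exact map_maskedShare_eq hinj _ C hC B B'
  · intro A B zA _ zB _ y hy
    rintro ⟨t, b, l⟩
    ext i j
    have hprob := (Finset.prod_ne_zero_iff.1 hy) (t, i, j) (Finset.mem_univ _)
    have hyc := hout _ _ hprob
    choose x hx hx' using fun b => exists_csaAnswer_eq hd0 hd hN hinj A B zA zB t i j b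
    have hinputs : (qcsaScheme T XA XB lam eta mu hN α u f ψ hψ P).inputs (t, i, j) A B zA zB =
        Sum.elim (fun k => u k * ((csaMatrix α f).mulVec (x 0)) k)
          (fun k => dualMultiplier α u k * ((csaMatrix α f).mulVec (x 1)) k) := by
      rw [← hx', ← hx']
      rfl
    change y (t, i, j) (desiredOutput b l) = _
    rw [hyc, hinputs, qcsaTransfer_mulVec_desiredOutput h2 hinj hu, ← hx b l ⟨l, by omega⟩ rfl]

end SchemeConstruction

/-! ### Counting products and qudits -/

section Rate

/-- The number of products of the blocks, in terms of the rate. -/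
theorem blocks_mul_two_csaDim {N XA XB K T : ℕ} (hN : 2 ≤ N) (hX : XA + XB < N)
    (hT : K * N = activeServers N XA XB * T) :
    ((T * (2 * csaDim N XA XB) : ℕ) : ℝ) =
      K * (N * min 1 (2 * (1 - ((XA : ℝ) + XB) / N))) := by
  have hN0 : (0 : ℝ) < N := by exact_mod_cast (by omega : 0 < N)
  rcases le_or_gt N (2 * (XA + XB)) with h | h
  · have hL : csaDim N XA XB = N - (XA + XB) := by unfold csaDim interferenceDim; omega
    have hn : activeServers N XA XB = N := by
      unfold activeServers csaDim interferenceDim; omega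
    have hTK : T = K := by
      rw [hn, mul_comm K] at hT
      exact (Nat.eq_of_mul_eq_mul_left (by omega) hT).symm
    have h' : (N : ℝ) ≤ 2 * (XA + XB) := by exact_mod_cast h
    have hle : 2 * (1 - ((XA : ℝ) + XB) / N) ≤ 1 := by
      have : (1 : ℝ) / 2 ≤ ((XA : ℝ) + XB) / N := by
        rw [le_div_iff₀ hN0]; linarith
      linarith
    rw [min_eq_right hle, hL, hTK]
    push_cast [Nat.cast_sub hX.le]
    field_simp
  -- With more than 2(X_A + X_B) servers the minimum in `csaDim` is the interference dimension, also
  -- when that was raised from 0 to 1, so every output is desired.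
  · have hn : activeServers N XA XB = 2 * csaDim N XA XB := by
      unfold activeServers csaDim interferenceDim; omega
    have h' : 2 * ((XA : ℝ) + XB) ≤ N := by exact_mod_cast h.le
    have hle : 1 ≤ 2 * (1 - ((XA : ℝ) + XB) / N) := by
      have : ((XA : ℝ) + XB) / N ≤ 1 / 2 := by
        rw [div_le_iff₀ hN0]; linarith
      linarith
    rw [min_eq_left hle, mul_one, ← hn, mul_comm T, ← hT]
    push_cast
    rfl

end Rate

end QCSA

end

theorem mainTheorem10 (p : ℕ) [Fact p.Prime] (F : Type u) [Field F] [Fintype F] [DecidableEq F]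
    [Algebra (ZMod p) F] (N XA XB lam eta mu : ℕ)
    (hN : 2 ≤ N) (hX : XA + XB < N) (hlam : 0 < lam) (hmu : 0 < mu)
    (hq : QCSA.activeServers N XA XB + QCSA.csaDim N XA XB ≤ Fintype.card F) :
    ∀ K : ℕ, 0 < K → QCSA.activeServers N XA XB ∣ K * N →
    ∃ (T : ℕ)
      (S : QCSA.Scheme F N (Fin T × Fin 2 × Fin (QCSA.csaDim N XA XB))
        (Fin T × Fin lam × Fin mu) (Fin (QCSA.activeServers N XA XB))
        (QCSA.BoxOutput (QCSA.activeServers N XA XB) (QCSA.csaDim N XA XB) → F) lam eta mu),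
      QCSA.IsQCSA p S ∧ S.SecureA XA ∧ S.SecureB XB ∧ S.Correct p ∧
      S.rate = min 1 (2 * (1 - ((XA : ℝ) + XB) / N)) ∧
      (S.numProducts : ℝ) = K * (N * min 1 (2 * (1 - ((XA : ℝ) + XB) / N))) ∧
      S.numQudits = K * (N * (lam * mu)) := by
  -- The number of blocks is T = KN/n, so that the Tλμ uses of n qudits amount to KNλμ qudits.
  rintro K hK ⟨T, hT⟩
  have hLd : QCSA.csaDim N XA XB ≤ QCSA.interferenceDim XA XB := min_le_right _ _
  have hd0 : 0 < QCSA.interferenceDim XA XB := by unfold QCSA.interferenceDim; omega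
  have hd : XA + XB ≤ QCSA.interferenceDim XA XB := le_max_right _ _
  have hle : QCSA.csaDim N XA XB + QCSA.interferenceDim XA XB ≤ N := by
    unfold QCSA.csaDim QCSA.interferenceDim; omega
  obtain ⟨S, hS, hA, hB, hC⟩ :=
    QCSA.exists_qcsa_scheme (F := F) p T XA XB lam eta mu hLd hd0 hd hle hq
  have hprod : (S.numProducts : ℝ) = K * (N * min 1 (2 * (1 - ((XA : ℝ) + XB) / N))) := by
    rw [← QCSA.blocks_mul_two_csaDim hN hX hT, QCSA.Scheme.numProducts]
    simp only [Fintype.card_prod, Fintype.card_fin]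
  have hqud : S.numQudits = K * (N * (lam * mu)) := by
    rw [QCSA.Scheme.numQudits, ← mul_assoc, hT, QCSA.activeServers]
    simp only [Fintype.card_prod, Fintype.card_fin]
    ring
  refine ⟨T, S, hS, hA, hB, hC, ?_, hprod, hqud⟩
  have hK' : (K : ℝ) ≠ 0 := by exact_mod_cast hK.ne'
  have hN' : (N : ℝ) ≠ 0 := by exact_mod_cast (by omega : N ≠ 0)
  have hlam' : (lam : ℝ) ≠ 0 := by exact_mod_cast hlam.ne'
  have hmu' : (mu : ℝ) ≠ 0 := by exact_mod_cast hmu.ne'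
  change ((S.numProducts * (lam * mu) : ℕ) : ℝ) / (S.numQudits : ℝ) = _
  rw [hqud]
  push_cast
  rw [hprod, div_eq_iff (by positivity)]
  ring
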